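/- **Theorem 4 (Symplectic formulation).** Let $\mathbb F_q$ be the field with $q$ elements and characteristic $p$. Equip $\mathbb F_q^{2n}$ with the symplectic form $\langle(a|b),(a'|b')\rangle_s=a\cdot b'-b\cdot a'$, write $S^{\perp s}$ for the symplectic dual of a subspace $S$, and let $\mathrm{wt}(a|b)$ be the number of $i$ with $(a_i,b_i)\ne(0,0)$. Let $\mathcal E_n$ be the group of operators $\zeta X(a)Z(b)$ on $(\mathbb C^q)^{\otimes n}$, where $X(a)Z(b)|y\rangle=\omega^{\mathrm{tr}(b\cdot y)}|y+a\rangle$ for $y\in\mathbb F_q^n$, $\omega=e^{2\pi i/p}$, $\mathrm{tr}:\mathbb F_q\to\mathbb F_p$ is the trace, and $\zeta^p=1$ if $p$ is odd, $\zeta^4=1$ if $p=2$; let $\tau(\zeta X(a)Z(b))=(a|b)$. A code $\mathcal Q\subseteq(\mathbb C^q)^{\otimes n}$ is *stabilized* by a subspace $T\subseteq\mathbb F_q^{2n}$ if it is the space of common fixed vectors of an Abelian subgroup $G\subseteq\mathcal E_n$ that contains no scalar other than $1$ and satisfies $\tau(G)=T$. An $[[m,k_b]]_q$ code is a subspace of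 $(\mathbb C^q)^{\otimes m}$ of dimension $q^{k_b}$. An $[[n,k,d;c]]_q$ EAQECC is a subspace $\mathcal Q\subseteq(\mathbb C^q)^{\otimes n}\otimes(\mathbb C^q)^{\otimes c}$ (Alice's and Bob's qudits) of the form $\{(W\otimes I)(\psi\otimes\Phi_c):\psi\in(\mathbb C^q)^{\otimes k}\}$, where $\Phi_c=q^{-c/2}\sum_{i\in\mathbb F_q^c}|i\rangle|i\rangle$ is the state of $c$ maximally entangled pairs, $W$ is an isometry from the $k$ information qudits and Alice's halves of the pairs to Alice's $n$ qudits, and $d$ is the least weight of a vector $(a|b)\in\mathbb F_q^{2n}$ such that $\mathcal Q$ does not detect the error $X(a)Z(b)$ on Alice's qudits ($d=\infty$ if there is none); $\mathcal Q$ detects $E$ if for some $\lambda\in\mathbb C$, $\langle u,Ev\rangle=\lambda\langle u,v\rangle$ for all $u,v\in\mathcal Q$. A subspace $S\subseteq\mathbb F_q^{2n}$ *EA-stabilizes* $\mathcal Q$ if $\mathcal Q$ is stabilized by a subspace $T\subseteq\mathbb F_q^{2(n+c)}$ that the restriction to Alice's coordinates maps bijectively onto $S$. Suppose a subspace $S\subseteq\mathbb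 F_q^{2n}$ decomposes as $S=S_I\oplus S_E$, where $S_I=S\cap S^{\perp s}$, $S_E\cap S_E^{\perp s}=\{0\}$, $|S_I|=q^l$ and $|S_E|=q^{2c}$. Let $S^b\subseteq\mathbb F_q^{2m}$ be a subspace with $S^b\subseteq (S^b)^{\perp s}$ and $|S^b|=q^r$. If $c\le m-r$, then there is a combination EAQECC-Ne (entanglement-assisted code with noisy ebits) $$\mathcal Q^{ea}_c=[[n,k,d_{ea};c]]_q+[[m,k_b]]_q,\qquad k=n-c-l,\quad k_b=m-r,\quad d_{ea}=\min\{\mathrm{wt}(g):g\in S^{\perp s}\setminus S_I\}$$ (with $\min\emptyset=\infty$). That is, there are an $[[n,k,d_{ea};c]]_q$ EAQECC $\mathcal Q^{ea}$ that is EA-stabilized by $S$, an $[[m,k_b]]_q$ code $\mathcal Q^b$ that is stabilized by $S^b$, with $k_b\ge c$, and an isometry $V:(\mathbb C^q)^{\otimes c}\to(\mathbb C^q)^{\otimes m}$ with image in $\mathcal Q^b$, by which Bob encodes his halves of the pairs, so that $\mathcal Q^{ea}_c=(I\otimes V)\mathcal Q^{ea}$. -/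

import Mathlib

open Matrix

set_option linter.unusedSectionVars false

noncomputable section

namespace EAQ

/-! ### The symplectic space `F_q^{2n}`

The qudits are indexed by a finite type `ι`, and `F` is the field with `q` elements. -/

/-- The space of pairs `(a|b)` of vectors with entries in `F` indexed by `ι`. -/
abbrev Symp (F ι : Type*) : Type _ := (ι → F) × (ι → F)

section Symplectic

variable {F ι : Type*} [Field F] [Fintype ι]

/-- The symplectic inner product `⟨(a|b), (a'|b')⟩ = a ⬝ b' - b ⬝ a'`. -/
def sympForm (u v : Symp F ι) : F := u.1 ⬝ᵥ v.2 - u.2 ⬝ᵥ v.1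

/-- The symplectic dual of a subspace. -/
def sympDual (S : Submodule F (Symp F ι)) : Submodule F (Symp F ι) where
  carrier := {u | ∀ v ∈ S, sympForm u v = 0}
  zero_mem' := by
    intro v _
    simp [sympForm]
  add_mem' := by
    intro u w hu hw v hv
    have h1 := hu v hv
    have h2 := hw v hv
    simp only [sympForm, Prod.fst_add, Prod.snd_add, add_dotProduct] at *
    linear_combination h1 + h2
  smul_mem' := by
    intro t u hu v hv
    have h1 := hu v hv
    simp only [sympForm, Prod.smul_fst, Prod.smul_snd, smul_dotProduct, smul_eq_mul] at *
    linear_combination t * h1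

variable [DecidableEq F]

/-- The weight of `(a|b)`: the number of positions `i` with `(a i, b i) ≠ (0, 0)`. -/
def weight (u : Symp F ι) : ℕ := (Finset.univ.filter fun i => u.1 i ≠ 0 ∨ u.2 i ≠ 0).card

/-- The least weight of an element of a set (`⊤` if the set is empty). -/
def minWeight (A : Set (Symp F ι)) : ℕ∞ := ⨅ u ∈ A, (weight u : ℕ∞)

end Symplectic

/-! ### Generalized Pauli operators

The state space of the qudits indexed by `ι` is `(ι → F) → ℂ`, with the computational basis
indexed by `ι → F` and the inner product `star u ⬝ᵥ v`. -/

section Pauli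

variable {F ι : Type*} [Field F] [Fintype F] [DecidableEq F] [Fintype ι] [DecidableEq ι]

/-- The phase `ω ^ tr x`, where `ω = exp (2 π i / p)`, `p` is the characteristic of `F`, and `tr`
is the trace from `F` to its prime field. -/
def phase (x : F) : ℂ :=
  letI : Algebra (ZMod (ringChar F)) F := ZMod.algebra F (ringChar F)
  Complex.exp (2 * Real.pi * Complex.I / (ringChar F : ℂ)) ^
    (Algebra.trace (ZMod (ringChar F)) F x).val

/-- The order of the group of scalars in the Pauli group: `p` for odd characteristic `p`, and
`4` for characteristic `2` (so that every operator `X(a) Z(b)` has a multiple of order `p`). -/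
def phaseOrder (F : Type*) [Field F] : ℕ := if ringChar F = 2 then 4 else ringChar F

/-- The operator `X(a) Z(b)` for `u = (a|b)`, sending the basis vector `|y⟩` to
`ω ^ tr (b ⬝ y) |y + a⟩`. -/
def pauli (u : Symp F ι) : Matrix (ι → F) (ι → F) ℂ :=
  Matrix.of fun x y => if x = y + u.1 then phase (u.2 ⬝ᵥ y) else 0

theorem phase_root : Complex.exp (2 * Real.pi * Complex.I / (ringChar F : ℂ)) ^ ringChar F = 1 := by
  have hp : ringChar F ≠ 0 := CharP.char_ne_zero_of_finite F (ringChar F)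
  rw [← Complex.exp_nat_mul, mul_div_cancel₀ _ (by exact_mod_cast hp)]
  exact Complex.exp_two_pi_mul_I

theorem phase_zero : phase (0 : F) = 1 := by
  simp [phase]

theorem phase_add (x y : F) : phase (x + y) = phase x * phase y := by
  have : NeZero (ringChar F) := ⟨CharP.char_ne_zero_of_finite F (ringChar F)⟩
  simp only [phase]
  rw [map_add, ← pow_add, ZMod.val_add, ← pow_eq_pow_mod _ phase_root]

theorem phase_pow (x : F) : phase x ^ phaseOrder F = 1 := by
  have h : phase x ^ ringChar F = 1 := by
    simp only [phase]
    rw [← pow_mul, Nat.mul_comm, pow_mul, phase_root, one_pow]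
  unfold phaseOrder
  split_ifs with h2
  · rw [h2] at h
    rw [show 4 = 2 * 2 from rfl, pow_mul, h, one_pow]
  · exact h

theorem pauli_zero : pauli (0 : Symp F ι) = 1 := by
  ext x y
  by_cases h : x = y <;> simp [pauli, h, phase_zero, Matrix.one_apply]

theorem pauli_mul (u v : Symp F ι) : pauli u * pauli v = phase (u.2 ⬝ᵥ v.1) • pauli (u + v) := by
  ext x y
  rw [Matrix.mul_apply, Finset.sum_eq_single (y + v.1)]
  · by_cases h : x = y + v.1 + u.1
    · have h' : x = y + (u.1 + v.1) := by rw [h]; abel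
      simp only [pauli, Matrix.of_apply, Matrix.smul_apply, if_pos h, if_pos h', Prod.fst_add,
        Prod.snd_add, if_true, dotProduct_add, add_dotProduct, phase_add, smul_eq_mul]
      ring
    · have h' : ¬ x = y + (u.1 + v.1) := by
        intro h2
        apply h
        rw [h2]; abel
      simp [pauli, h, h']
  · intro z _ hz
    simp [pauli, hz]
  · simp

/-- The generalized Pauli group: the unitary operators `z • X(a) Z(b)` with an admissible
scalar `z`. -/
def pauliGroup (F ι : Type*) [Field F] [Fintype F] [DecidableEq F] [Fintype ι] [DecidableEq ι] :
    Subgroup (Matrix.unitaryGroup (ι → F) ℂ) where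
  carrier := {g | ∃ z : ℂ, z ^ phaseOrder F = 1 ∧ ∃ u : Symp F ι,
    (g : Matrix (ι → F) (ι → F) ℂ) = z • pauli u}
  one_mem' := ⟨1, one_pow _, 0, by simp [pauli_zero]⟩
  mul_mem' := by
    rintro g h ⟨z, hz, u, hu⟩ ⟨w, hw, v, hv⟩
    refine ⟨z * w * phase (u.2 ⬝ᵥ v.1), ?_, u + v, ?_⟩
    · rw [mul_pow, mul_pow, hz, hw, phase_pow]
      simp
    · rw [Matrix.UnitaryGroup.mul_val, hu, hv, smul_mul_smul_comm, pauli_mul, smul_smul]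
  inv_mem' := by
    rintro g ⟨z, hz, u, hu⟩
    have hF : phaseOrder F ≠ 0 := by
      unfold phaseOrder
      split_ifs
      · norm_num
      · exact CharP.char_ne_zero_of_finite F (ringChar F)
    have hz0 : z ≠ 0 := by
      rintro rfl
      rw [zero_pow hF] at hz
      exact zero_ne_one hz
    have hp0 : phase (u.2 ⬝ᵥ u.1) ≠ 0 := by
      intro h0
      have := phase_pow (u.2 ⬝ᵥ u.1)
      rw [h0, zero_pow hF] at this
      exact zero_ne_one this
    refine ⟨z⁻¹ * phase (u.2 ⬝ᵥ u.1), ?_, -u, ?_⟩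
    · rw [mul_pow, inv_pow, hz, phase_pow]
      simp
    · have h1 : (g : Matrix (ι → F) (ι → F) ℂ) * ((z⁻¹ * phase (u.2 ⬝ᵥ u.1)) • pauli (-u)) = 1 := by
        rw [hu, smul_mul_smul_comm, pauli_mul, smul_smul, add_neg_cancel, pauli_zero,
          Prod.fst_neg, dotProduct_neg]
        have h2 : phase (u.2 ⬝ᵥ u.1) * phase (-(u.2 ⬝ᵥ u.1)) = 1 := by
          rw [← phase_add, add_neg_cancel, phase_zero]
        rw [mul_inv_cancel_left₀ hz0, h2, one_smul]
      have h3 : ((g⁻¹ : Matrix.unitaryGroup (ι → F) ℂ) : Matrix (ι → F) (ι → F) ℂ) *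
          (g : Matrix (ι → F) (ι → F) ℂ) = 1 := by
        rw [← Matrix.UnitaryGroup.mul_val, inv_mul_cancel, Matrix.UnitaryGroup.one_val]
      exact left_inv_eq_right_inv h3 h1

/-- The image of a subgroup under the map `τ : z • X(a) Z(b) ↦ (a|b)`. -/
def tau (G : Subgroup (Matrix.unitaryGroup (ι → F) ℂ)) : Set (Symp F ι) :=
  {u | ∃ g ∈ G, ∃ z : ℂ, (g : Matrix (ι → F) (ι → F) ℂ) = z • pauli u}

/-- The space of states fixed by all elements of a group of unitary operators. -/
def fixedSpace (G : Subgroup (Matrix.unitaryGroup (ι → F) ℂ)) : Submodule ℂ ((ι → F) → ℂ) where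
  carrier := {v | ∀ g ∈ G, (g : Matrix (ι → F) (ι → F) ℂ) *ᵥ v = v}
  zero_mem' := by
    intro g _
    exact Matrix.mulVec_zero _
  add_mem' := by
    intro v w hv hw g hg
    rw [Matrix.mulVec_add, hv g hg, hw g hg]
  smul_mem' := by
    intro t v hv g hg
    rw [Matrix.mulVec_smul, hv g hg]

/-- `Q` is a stabilizer code with symplectic stabilizer `T`: it is the fixed space of an Abelian
subgroup of the Pauli group that contains no scalar other than `1` and has image `T`. -/
def Stabilizes (T : Submodule F (Symp F ι)) (Q : Submodule ℂ ((ι → F) → ℂ)) : Prop :=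
  ∃ G : Subgroup (Matrix.unitaryGroup (ι → F) ℂ), G ≤ pauliGroup F ι ∧
    (∀ g ∈ G, ∀ h ∈ G, g * h = h * g) ∧
    (∀ g ∈ G, ∀ z : ℂ, (g : Matrix (ι → F) (ι → F) ℂ) = z • 1 → z = 1) ∧
    tau G = (T : Set (Symp F ι)) ∧ Q = fixedSpace G

/-- `Q` is an `[[m, k]]_q` code, where `m` is the number of elements of `ι`: a subspace of
dimension `q ^ k` of the state space of `m` qudits. -/
def IsQECC (k : ℕ) (Q : Submodule ℂ ((ι → F) → ℂ)) : Prop :=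
  Module.finrank ℂ Q = Fintype.card F ^ k

/-- The code `Q` detects the error operator `E` (the Knill–Laflamme condition). -/
def Detects (Q : Submodule ℂ ((ι → F) → ℂ)) (E : Matrix (ι → F) (ι → F) ℂ) : Prop :=
  ∃ t : ℂ, ∀ u ∈ Q, ∀ v ∈ Q, star u ⬝ᵥ (E *ᵥ v) = t * (star u ⬝ᵥ v)

end Pauli

/-! ### Entanglement-assisted codes

Alice's qudits are indexed by `Fin n`, Bob's halves of the `c` ebits by `Fin c`. -/

section EA

variable {F : Type*} [Field F] [Fintype F] [DecidableEq F] {n m k c : ℕ}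

/-- The restriction of `(a|b)` to Alice's positions. -/
def alicePart (u : Symp F (Fin n ⊕ Fin c)) : Symp F (Fin n) := (u.1 ∘ Sum.inl, u.2 ∘ Sum.inl)

/-- The vector `(a|b)` on Alice's positions, extended by zero to Bob's. -/
def onAlice (c : ℕ) (u : Symp F (Fin n)) : Symp F (Fin n ⊕ Fin c) :=
  (Sum.elim u.1 0, Sum.elim u.2 0)

/-- `S` EA-stabilizes `Q`: by adding `c` coordinates to each of its elements, `S` is extended to
the symplectic image `T` of an Abelian group that stabilizes `Q`. -/
def EAStabilizes (S : Submodule F (Symp F (Fin n)))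
    (Q : Submodule ℂ ((Fin n ⊕ Fin c → F) → ℂ)) : Prop :=
  ∃ T : Submodule F (Symp F (Fin n ⊕ Fin c)),
    Set.BijOn alicePart (T : Set (Symp F (Fin n ⊕ Fin c))) (S : Set (Symp F (Fin n))) ∧
    Stabilizes T Q

/-- The amplitudes of `c` maximally entangled pairs:
`q ^ (-c / 2)` times the sum of all `|i⟩ ⊗ |i⟩`. -/
def ebits (i j : Fin c → F) : ℂ :=
  if i = j then (((Real.sqrt ((Fintype.card F : ℝ) ^ c))⁻¹ : ℝ) : ℂ) else 0

/-- The operator `ψ ↦ (W ⊗ 1) (ψ ⊗ ebits)` from `k` qudits to the `n` qudits of Alice and the `c`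
qudits of Bob, where `W` acts on the `k` information qudits and on Alice's halves of the ebits. -/
def eaEncoder (W : Matrix (Fin n → F) ((Fin k → F) × (Fin c → F)) ℂ) :
    Matrix (Fin n ⊕ Fin c → F) (Fin k → F) ℂ :=
  Matrix.of fun x s => ∑ i : Fin c → F, W (x ∘ Sum.inl) (s, i) * ebits i (x ∘ Sum.inr)

/-- The minimum distance of `Q` with respect to errors on Alice's qudits: the least weight of a
Pauli error on them that `Q` does not detect. -/
def eaDistance (Q : Submodule ℂ ((Fin n ⊕ Fin c → F) → ℂ)) : ℕ∞ :=
  minWeight {u : Symp F (Fin n) | ¬ Detects Q (pauli (onAlice c u))}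

/-- `Q` is an `[[n, k, d; c]]_q` entanglement-assisted code: Alice applies an isometry `W` (a
unitary operator after adjoining `n - k - c` ancillas) to `k` information qudits and to her halves
of `c` maximally entangled pairs, and the distance against errors on her qudits is `d`. -/
def IsEAQECC (k : ℕ) (d : ℕ∞) (Q : Submodule ℂ ((Fin n ⊕ Fin c → F) → ℂ)) : Prop :=
  (∃ W : Matrix (Fin n → F) ((Fin k → F) × (Fin c → F)) ℂ,
    Wᴴ * W = 1 ∧ Q = LinearMap.range (eaEncoder W).mulVecLin) ∧
  eaDistance Q = d

/-- The operator `1 ⊗ V`, where `V` encodes Bob's `c` qudits into `m` qudits. -/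
def bobEncoder (n : ℕ) (V : Matrix (Fin m → F) (Fin c → F) ℂ) :
    Matrix (Fin n ⊕ Fin m → F) (Fin n ⊕ Fin c → F) ℂ :=
  Matrix.of fun x y =>
    if x ∘ Sum.inl = y ∘ Sum.inl then V (x ∘ Sum.inr) (y ∘ Sum.inr) else 0

/-- `Qc` is the combination `[[n, k, d; c]]_q + [[m, kb]]_q` of the entanglement-assisted code `Qea`
with EA-stabilizer `S` and the code `Qb` with stabilizer `Sb`: Bob protects his halves of the `c`
ebits by encoding them isometrically into `Qb`. -/
structure IsCombination (S : Submodule F (Symp F (Fin n))) (Sb : Submodule F (Symp F (Fin m)))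
    (k : ℕ) (d : ℕ∞) (kb : ℕ)
    (Qea : Submodule ℂ ((Fin n ⊕ Fin c → F) → ℂ))
    (Qb : Submodule ℂ ((Fin m → F) → ℂ))
    (Qc : Submodule ℂ ((Fin n ⊕ Fin m → F) → ℂ)) : Prop where
  ea_stabilizes : EAStabilizes S Qea
  ea_code : IsEAQECC k d Qea
  stabilizes : Stabilizes Sb Qb
  code : IsQECC kb Qb
  matching : c ≤ kb
  joined : ∃ V : Matrix (Fin m → F) (Fin c → F) ℂ, Vᴴ * V = 1 ∧
    LinearMap.range V.mulVecLin ≤ Qb ∧ Qc = Qea.map (bobEncoder n V).mulVecLin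

end EA

end EAQ

end

namespace EAQ

/-! The symplectic form restricted to `S` has radical `S_I` and rank `2c`. Hence there is a
surjection `B` from `S` onto the symplectic space of `c` qudits that negates the form
(`exists_surjective_sympForm_eq_neg`). The graph of `B`, `T = {(s | B s)}`, is isotropic and
restricts bijectively to `S`.

An isotropic space lifts to a stabilizer group: the scalars are inverse eigenvalues on a common
eigenvector (`exists_isPhaseLift`). Averaging the group gives the projection onto the code. Its
trace gives the dimension, here `q ^ (n + c - (l + 2c)) = q ^ (n - c - l)`, and `detects_iff` shows
that the undetected errors are exactly those in the dual of `T` but not in `T`. For errors on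
Alice's side these are the vectors of the dual of `S` outside `S_I`.

The encoder form comes from the surjectivity of `B`: every nontrivial Pauli operator on Bob's side
fails to commute with some stabilizer, so its matrix elements on the code vanish and Bob's share is
maximally mixed. Rescaling an orthonormal basis of the code then yields the isometry `W`
(`exists_eaEncoder`). For Bob's code, `c ≤ m - r` leaves room for an isometry `V` into it. -/

theorem exists_common_eigenvector {ι V : Type*} [AddCommGroup V] [Module ℂ V]
    [FiniteDimensional ℂ V] [Nontrivial V] (f : ι → Module.End ℂ V)
    (hf : ∀ i j, f i * f j = f j * f i) : ∃ v : V, v ≠ 0 ∧ ∀ i, ∃ μ : ℂ, f i v = μ • v := by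
  let A : Set (Submodule ℂ V) := {p | p ≠ ⊥ ∧ ∀ i, ∀ v ∈ p, f i v ∈ p}
  have hA : A.Nonempty := ⟨⊤, top_ne_bot, fun _ _ _ => trivial⟩
  -- On a minimal nonzero invariant subspace every operator is scalar: by commutation its
  -- eigenspaces there are invariant under the whole family. This works for any index type.
  obtain ⟨p, ⟨hp0, hp⟩, hmin⟩ := WellFounded.has_min
    (wellFounded_lt : WellFounded ((· < ·) : Submodule ℂ V → Submodule ℂ V → Prop)) A hA
  obtain ⟨v, hv, hv0⟩ := Submodule.exists_mem_ne_zero_of_ne_bot hp0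
  refine ⟨v, hv0, fun i => ?_⟩
  have : Nontrivial p := Submodule.nontrivial_iff_ne_bot.2 hp0
  obtain ⟨μ, hμ⟩ := Module.End.exists_eigenvalue ((f i).restrict (hp i))
  obtain ⟨w, hw⟩ := hμ.exists_hasEigenvector
  refine ⟨μ, ?_⟩
  have hmem : p ⊓ Module.End.eigenspace (f i) μ ∈ A := by
    refine ⟨fun h => hw.2 ?_, ?_⟩
    · have h1 : (w : V) ∈ p ⊓ Module.End.eigenspace (f i) μ := by
        refine ⟨w.2, Module.End.mem_eigenspace_iff.2 ?_⟩
        simpa using congrArg Subtype.val hw.apply_eq_smul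
      rw [h, Submodule.mem_bot] at h1
      exact Subtype.ext h1
    · rintro j x ⟨hx, hxe⟩
      refine ⟨hp j x hx, Module.End.mem_eigenspace_iff.2 ?_⟩
      have h2 := LinearMap.congr_fun (hf i j) x
      simp only [Module.End.mul_apply] at h2
      rw [h2, Module.End.mem_eigenspace_iff.1 hxe, map_smul]
  have hle : p ≤ p ⊓ Module.End.eigenspace (f i) μ := by
    by_contra hcon
    exact hmin _ hmem (lt_of_le_of_ne inf_le_left fun h => hcon h.ge)
  exact Module.End.mem_eigenspace_iff.1 (hle hv).2

/-! ### Additive characters of the field. -/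

section Phase

variable {F : Type*} [Field F] [Fintype F] [DecidableEq F]

theorem phaseOrder_ne_zero : phaseOrder F ≠ 0 := by
  unfold phaseOrder
  split_ifs
  · norm_num
  · exact CharP.char_ne_zero_of_finite F (ringChar F)

theorem phase_neg_mul (x : F) : phase (-x) * phase x = 1 := by
  rw [← phase_add, neg_add_cancel, phase_zero]

theorem phase_ne_zero (x : F) : phase x ≠ 0 := right_ne_zero_of_mul_eq_one (phase_neg_mul x)

theorem star_eq_inv_of_pow_eq_one {z : ℂ} {N : ℕ} (hN : N ≠ 0) (hz : z ^ N = 1) :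
    star z = z⁻¹ := by
  rw [Complex.inv_eq_conj (Complex.norm_eq_one_of_pow_eq_one hz hN)]
  rfl

theorem star_phase (x : F) : star (phase x) = phase (-x) := by
  rw [star_eq_inv_of_pow_eq_one phaseOrder_ne_zero (phase_pow x)]
  exact (eq_inv_of_mul_eq_one_left (phase_neg_mul x)).symm

theorem exists_phase_ne_one : ∃ x : F, phase x ≠ 1 := by
  let _ : Algebra (ZMod (ringChar F)) F := ZMod.algebra F (ringChar F)
  have hp : ringChar F ≠ 0 := CharP.char_ne_zero_of_finite F (ringChar F)
  have : NeZero (ringChar F) := ⟨hp⟩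
  obtain ⟨b, hb⟩ := FiniteField.trace_to_zmod_nondegenerate F (one_ne_zero (α := F))
  rw [one_mul] at hb
  refine ⟨b, fun h => hb ?_⟩
  have h1 := (Complex.isPrimitiveRoot_exp (ringChar F) hp).dvd_of_pow_eq_one _ h
  exact (ZMod.val_eq_zero _).1 (Nat.eq_zero_of_dvd_of_lt h1 (ZMod.val_lt _))

/-- A nonzero `x` can have trace zero, so a nonzero symplectic product need not give a nontrivial
phase. Rescaling repairs this, and is available because stabilizers are `F`-subspaces. -/
theorem exists_phase_mul_ne_one {x : F} (hx : x ≠ 0) : ∃ t : F, phase (t * x) ≠ 1 := by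
  obtain ⟨y, hy⟩ := exists_phase_ne_one (F := F)
  exact ⟨y * x⁻¹, by rwa [inv_mul_cancel_right₀ hx]⟩

/-- If `z i ≠ 0`, translating `b` in coordinate `i` multiplies the sum by a phase other than `1`. -/
theorem sum_phase_dotProduct {ι : Type*} [Fintype ι] [DecidableEq ι] (z : ι → F) :
    ∑ b : ι → F, phase (b ⬝ᵥ z) = if z = 0 then (Fintype.card (ι → F) : ℂ) else 0 := by
  split_ifs with h
  · simp [h, phase_zero]
  · obtain ⟨i, hi⟩ := Function.ne_iff.1 h
    obtain ⟨t, ht⟩ := exists_phase_mul_ne_one hi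
    have h1 : phase (t * z i) * ∑ b : ι → F, phase (b ⬝ᵥ z) = ∑ b : ι → F, phase (b ⬝ᵥ z) := by
      conv_rhs => rw [← Equiv.sum_comp (Equiv.addLeft (Pi.single i t))]
      simp [add_dotProduct, phase_add, Finset.mul_sum]
    have h2 : (phase (t * z i) - 1) * ∑ b : ι → F, phase (b ⬝ᵥ z) = 0 := by
      rw [sub_mul, h1, one_mul, sub_self]
    exact (mul_eq_zero.1 h2).resolve_left (sub_ne_zero.2 ht)

theorem cast_phaseOrder : (phaseOrder F : F) = 0 := by
  unfold phaseOrder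
  split_ifs with h
  · have : ((2 : ℕ) : F) = 0 := by rw [← h]; exact ringChar.Nat.cast_ringChar
    have h4 : ((4 : ℕ) : F) = (2 : ℕ) * (2 : ℕ) := by norm_num
    rw [h4, this, zero_mul]
  · exact ringChar.Nat.cast_ringChar

/-- This kills the phase in `pauli_pow`. In characteristic 2 the exponent must be 4, since `2.choose
2 = 1` is odd but `4.choose 2 = 6` is even. -/
theorem cast_choose_phaseOrder : ((phaseOrder F).choose 2 : F) = 0 := by
  have hp : (ringChar F).Prime := CharP.char_is_prime F _
  rw [ringChar.spec]
  unfold phaseOrder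
  split_ifs with h
  · rw [h]; decide
  · exact hp.dvd_choose_self two_ne_zero (lt_of_le_of_ne hp.two_le (Ne.symm h))

end Phase

/-! ### Commutation, powers and traces of Pauli operators; lifting isotropic spaces. -/

section Pauli

variable {F ι : Type*} [Field F] [Fintype F] [DecidableEq F] [Fintype ι] [DecidableEq ι]

theorem sympForm_swap (u v : Symp F ι) : sympForm u v = -sympForm v u := by
  simp only [sympForm, dotProduct_comm u.1, dotProduct_comm u.2]
  ring

theorem sympForm_smul_left (t : F) (u v : Symp F ι) : sympForm (t • u) v = t * sympForm u v := by
  simp only [sympForm, Prod.smul_fst, Prod.smul_snd, smul_dotProduct, smul_eq_mul]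
  ring

theorem pauli_commute (u v : Symp F ι) :
    pauli u * pauli v = phase (-sympForm u v) • (pauli v * pauli u) := by
  rw [pauli_mul, pauli_mul, smul_smul, ← phase_add, add_comm v u]
  congr 2
  simp only [sympForm, dotProduct_comm u.1]
  ring

theorem pauli_pow (u : Symp F ι) (k : ℕ) :
    pauli u ^ k = phase ((k.choose 2 : F) * (u.2 ⬝ᵥ u.1)) • pauli (k • u) := by
  induction k with
  | zero => simp [phase_zero, pauli_zero]
  | succ k ih =>
    rw [pow_succ, ih, smul_mul_assoc, pauli_mul, smul_smul, ← phase_add, ← succ_nsmul]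
    congr 2
    rw [Nat.choose_succ_succ' k 1]
    rw [Prod.smul_snd, smul_dotProduct, Nat.choose_one_right, nsmul_eq_mul]
    push_cast
    ring

theorem pauli_pow_phaseOrder (u : Symp F ι) : pauli u ^ phaseOrder F = 1 := by
  rw [pauli_pow, cast_choose_phaseOrder, zero_mul, phase_zero, one_smul]
  have : phaseOrder F • u = 0 := by
    rw [← Nat.cast_smul_eq_nsmul F, cast_phaseOrder, zero_smul]
  rw [this, pauli_zero]

theorem trace_pauli (u : Symp F ι) :
    (pauli u).trace = if u = 0 then (Fintype.card (ι → F) : ℂ) else 0 := by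
  by_cases h1 : u.1 = 0
  · have h2 : (pauli u).trace = ∑ y : ι → F, phase (y ⬝ᵥ u.2) := by
      simp [Matrix.trace, pauli, h1, dotProduct_comm]
    have h3 : u = 0 ↔ u.2 = 0 := by simp [Prod.ext_iff, h1]
    rw [h2, sum_phase_dotProduct]
    simp only [h3]
  · have h3 : u ≠ 0 := fun h => h1 (by rw [h]; rfl)
    simp [Matrix.trace, pauli, h1, h3]

/-- Pauli operators are trace-orthogonal: after multiplication by `pauli (-u)`, only a multiple of
the identity has nonzero trace. This makes `tau` of a lifted group computable. -/
theorem eq_of_smul_pauli_eq {a b : ℂ} {u v : Symp F ι} (ha : a ≠ 0)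
    (h : a • pauli u = b • pauli v) : u = v := by
  have h1 := congrArg (fun M => (pauli (-u) * M).trace) h
  simp only [mul_smul_comm, pauli_mul, neg_add_cancel, Matrix.trace_smul, trace_pauli,
    if_true, smul_eq_mul] at h1
  by_contra hne
  rw [if_neg (fun h0 => hne (neg_add_eq_zero.1 h0)), mul_zero, mul_zero] at h1
  have : (Fintype.card (ι → F) : ℂ) ≠ 0 := Nat.cast_ne_zero.2 Fintype.card_ne_zero
  exact mul_ne_zero ha (mul_ne_zero (phase_ne_zero _) this) h1

theorem conjTranspose_pauli_mul (u : Symp F ι) : (pauli u)ᴴ * pauli u = 1 := by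
  ext x y
  rw [Matrix.mul_apply, Finset.sum_eq_single (y + u.1)]
  · by_cases h : x = y
    · subst h
      simp only [Matrix.conjTranspose_apply, pauli, Matrix.of_apply, if_true, Matrix.one_apply_eq]
      rw [star_phase, phase_neg_mul]
    · have h' : ¬ y = x := fun h2 => h h2.symm
      simp [pauli, h, h']
  · intro w _ hw
    simp [pauli, hw]
  · simp

theorem smul_pauli_mem_unitaryGroup {z : ℂ} (hz : z ^ phaseOrder F = 1) (u : Symp F ι) :
    z • pauli u ∈ Matrix.unitaryGroup (ι → F) ℂ := by
  have hz0 : z ≠ 0 := by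
    rintro rfl
    rw [zero_pow phaseOrder_ne_zero] at hz
    exact zero_ne_one hz
  rw [Matrix.mem_unitaryGroup_iff', Matrix.star_eq_conjTranspose, Matrix.conjTranspose_smul,
    smul_mul_smul_comm, conjTranspose_pauli_mul, star_eq_inv_of_pow_eq_one phaseOrder_ne_zero hz,
    inv_mul_cancel₀ hz0, one_smul]

/-- A choice of scalars `z` making `u ↦ z u • X(a) Z(b)` multiplicative on `T`. -/
structure IsPhaseLift (T : Submodule F (Symp F ι)) (z : Symp F ι → ℂ) : Prop where
  pow_eq_one : ∀ u ∈ T, z u ^ phaseOrder F = 1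
  map_add : ∀ u ∈ T, ∀ v ∈ T, z (u + v) = z u * z v * phase (u.2 ⬝ᵥ v.1)

/-- Isotropy makes the operators commute, so they share an eigenvector. Comparing eigenvalues in
`pauli_mul` shows that they satisfy the required cocycle relation up to inversion, and
`pauli_pow_phaseOrder` makes them roots of unity. -/
theorem exists_isPhaseLift {T : Submodule F (Symp F ι)} (hT : T ≤ sympDual T) :
    ∃ z, IsPhaseLift T z := by
  obtain ⟨v, hv0, hv⟩ := exists_common_eigenvector
    (fun u : T => (Matrix.toLin' (pauli (u : Symp F ι)) : Module.End ℂ ((ι → F) → ℂ))) (by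
      intro s t
      have h : sympForm (s : Symp F ι) t = 0 := hT s.2 t t.2
      rw [Module.End.mul_eq_comp, Module.End.mul_eq_comp, ← Matrix.toLin'_mul,
        ← Matrix.toLin'_mul, pauli_commute, h, neg_zero,
        phase_zero, one_smul])
  choose μ hμ using hv
  simp only [Matrix.toLin'_apply] at hμ
  have hmul : ∀ s t : T, μ s * μ t = phase ((s : Symp F ι).2 ⬝ᵥ (t : Symp F ι).1) * μ (s + t) := by
    intro s t
    have h1 : (pauli (s : Symp F ι) * pauli (t : Symp F ι)) *ᵥ v = (μ s * μ t) • v := by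
      rw [← Matrix.mulVec_mulVec, hμ, Matrix.mulVec_smul, hμ, smul_smul, mul_comm]
    rw [pauli_mul, Matrix.smul_mulVec, ← Submodule.coe_add, hμ, smul_smul] at h1
    exact (smul_left_injective ℂ hv0 h1).symm
  have hpow : ∀ s : T, μ s ^ phaseOrder F = 1 := by
    intro s
    have h1 : ∀ k : ℕ, (pauli (s : Symp F ι) ^ k) *ᵥ v = (μ s ^ k) • v := by
      intro k
      induction k with
      | zero => simp
      | succ k ih =>
        rw [pow_succ', ← Matrix.mulVec_mulVec, ih, Matrix.mulVec_smul, hμ, smul_smul, pow_succ]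
    have h2 := h1 (phaseOrder F)
    rw [pauli_pow_phaseOrder, Matrix.one_mulVec] at h2
    exact (smul_left_injective ℂ hv0 ((one_smul ℂ v).trans h2)).symm
  have hne : ∀ s : T, μ s ≠ 0 := by
    intro s h
    have := hpow s
    rw [h, zero_pow phaseOrder_ne_zero] at this
    exact zero_ne_one this
  classical
  -- Dividing by the eigenvalue makes each operator fix `v`. The value outside `T` is arbitrary.
  refine ⟨fun u => if h : u ∈ T then (μ ⟨u, h⟩)⁻¹ else 1, ?_, ?_⟩
  · intro u hu
    simp only [dif_pos hu, inv_pow, hpow, inv_one]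
  · intro u hu w hw
    simp only [dif_pos hu, dif_pos hw, dif_pos (T.add_mem hu hw)]
    have := hmul ⟨u, hu⟩ ⟨w, hw⟩
    rw [← mul_inv, this, mul_inv, mul_right_comm, inv_mul_cancel₀ (phase_ne_zero _), one_mul]
    rfl

end Pauli

/-! ### Stabilizer codes: projection, dimension and detected errors. -/

section Stabilizer

variable {F ι : Type*} [Field F] [Fintype F] [DecidableEq F] [Fintype ι] [DecidableEq ι]

namespace IsPhaseLift

variable {T : Submodule F (Symp F ι)} {z : Symp F ι → ℂ}

theorem ne_zero (hz : IsPhaseLift T z) {u : Symp F ι} (hu : u ∈ T) : z u ≠ 0 := by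
  intro h
  have := hz.pow_eq_one u hu
  rw [h, zero_pow phaseOrder_ne_zero] at this
  exact zero_ne_one this

theorem map_zero (hz : IsPhaseLift T z) : z 0 = 1 := by
  have h := hz.map_add 0 T.zero_mem 0 T.zero_mem
  rw [add_zero, Prod.snd_zero, zero_dotProduct, phase_zero, mul_one] at h
  exact (mul_eq_left₀ (hz.ne_zero T.zero_mem)).1 h.symm

theorem smul_pauli_mul (hz : IsPhaseLift T z) {u v : Symp F ι} (hu : u ∈ T) (hv : v ∈ T) :
    (z u • pauli u) * (z v • pauli v) = z (u + v) • pauli (u + v) := by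
  rw [smul_mul_smul_comm, pauli_mul, smul_smul, hz.map_add u hu v hv]

/-- The stabilizer group of the operators `z u • X(a) Z(b)` for `u = (a|b)` in `T`. -/
def group (hz : IsPhaseLift T z) : Subgroup (Matrix.unitaryGroup (ι → F) ℂ) where
  carrier := {g | ∃ u ∈ T, (g : Matrix (ι → F) (ι → F) ℂ) = z u • pauli u}
  one_mem' := ⟨0, T.zero_mem, by simp [hz.map_zero, pauli_zero]⟩
  mul_mem' := by
    rintro g h ⟨u, hu, hg⟩ ⟨v, hv, hh⟩
    exact ⟨u + v, T.add_mem hu hv, by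
      rw [Matrix.UnitaryGroup.mul_val, hg, hh, hz.smul_pauli_mul hu hv]⟩
  inv_mem' := by
    rintro g ⟨u, hu, hg⟩
    refine ⟨-u, T.neg_mem hu, ?_⟩
    have h1 : (g : Matrix (ι → F) (ι → F) ℂ) * (z (-u) • pauli (-u)) = 1 := by
      rw [hg, hz.smul_pauli_mul hu (T.neg_mem hu), add_neg_cancel, hz.map_zero, one_smul,
        pauli_zero]
    have h2 : ((g⁻¹ : Matrix.unitaryGroup (ι → F) ℂ) : Matrix (ι → F) (ι → F) ℂ) *
        (g : Matrix (ι → F) (ι → F) ℂ) = 1 := by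
      rw [← Matrix.UnitaryGroup.mul_val, inv_mul_cancel, Matrix.UnitaryGroup.one_val]
    exact left_inv_eq_right_inv h2 h1

theorem mem_fixedSpace (hz : IsPhaseLift T z) {x : (ι → F) → ℂ} :
    x ∈ fixedSpace hz.group ↔ ∀ u ∈ T, (z u • pauli u) *ᵥ x = x := by
  constructor
  · intro h u hu
    exact h ⟨z u • pauli u, smul_pauli_mem_unitaryGroup (hz.pow_eq_one u hu) u⟩ ⟨u, hu, rfl⟩
  · rintro h g ⟨u, hu, hg⟩
    rw [hg, h u hu]

theorem stabilizes (hz : IsPhaseLift T z) : Stabilizes T (fixedSpace hz.group) := by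
  refine ⟨hz.group, ?_, ?_, ?_, ?_, rfl⟩
  · rintro g ⟨u, hu, hg⟩
    exact ⟨z u, hz.pow_eq_one u hu, u, hg⟩
  · rintro g ⟨u, hu, hg⟩ h ⟨v, hv, hh⟩
    apply Subtype.ext
    rw [Matrix.UnitaryGroup.mul_val, Matrix.UnitaryGroup.mul_val, hg, hh,
      hz.smul_pauli_mul hu hv, hz.smul_pauli_mul hv hu, add_comm]
  · rintro g ⟨u, hu, hg⟩ w hw
    rw [hg, ← pauli_zero] at hw
    obtain rfl := eq_of_smul_pauli_eq (hz.ne_zero hu) hw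
    rw [hz.map_zero, one_smul, pauli_zero] at hw
    have h := congrFun (congrFun hw 0) 0
    simpa using h.symm
  · ext v
    constructor
    · rintro ⟨g, ⟨u, hu, hg⟩, w, hw⟩
      rw [hg] at hw
      rwa [← eq_of_smul_pauli_eq (hz.ne_zero hu) hw]
    · intro hv
      exact ⟨⟨z v • pauli v, smul_pauli_mem_unitaryGroup (hz.pow_eq_one v hv) v⟩, ⟨v, hv, rfl⟩,
        z v, rfl⟩

/-- The average of the stabilizer group, which is the projection onto the code. -/
noncomputable def proj (_ : IsPhaseLift T z) [Fintype T] : Matrix (ι → F) (ι → F) ℂ :=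
  (Fintype.card T : ℂ)⁻¹ • ∑ u : T, z u • pauli (u : Symp F ι)

theorem smul_pauli_mul_proj (hz : IsPhaseLift T z) [Fintype T] {u : Symp F ι} (hu : u ∈ T) :
    (z u • pauli u) * hz.proj = hz.proj := by
  unfold proj
  rw [mul_smul_comm, Finset.mul_sum]
  congr 1
  conv_rhs => rw [← Equiv.sum_comp (Equiv.addLeft (⟨u, hu⟩ : T))]
  exact Finset.sum_congr rfl fun v _ => hz.smul_pauli_mul hu v.2

theorem isProj_proj (hz : IsPhaseLift T z) [Fintype T] :
    LinearMap.IsProj (fixedSpace hz.group) (Matrix.toLin' hz.proj) := by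
  constructor
  · intro x
    rw [hz.mem_fixedSpace]
    intro u hu
    rw [Matrix.toLin'_apply, Matrix.mulVec_mulVec, hz.smul_pauli_mul_proj hu]
  · intro x hx
    rw [hz.mem_fixedSpace] at hx
    rw [Matrix.toLin'_apply, proj, Matrix.smul_mulVec, Matrix.sum_mulVec,
      Finset.sum_congr rfl fun (u : T) _ => hx u u.2, Finset.sum_const, Finset.card_univ,
      ← Nat.cast_smul_eq_nsmul ℂ, smul_smul, inv_mul_cancel₀, one_smul]
    exact Nat.cast_ne_zero.2 Fintype.card_ne_zero

theorem trace_pauli_mul_proj (hz : IsPhaseLift T z) [Fintype T] {u : Symp F ι} (hu : u ∉ T) :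
    (pauli u * hz.proj).trace = 0 := by
  rw [proj, mul_smul_comm, Finset.mul_sum, Matrix.trace_smul, Matrix.trace_sum,
    Finset.sum_eq_zero, smul_zero]
  intro v _
  rw [mul_smul_comm, pauli_mul, Matrix.trace_smul, Matrix.trace_smul, trace_pauli, if_neg,
    smul_zero, smul_zero]
  intro h
  exact hu (by rw [eq_neg_of_add_eq_zero_left h]; exact T.neg_mem v.2)

theorem trace_proj (hz : IsPhaseLift T z) [Fintype T] :
    hz.proj.trace = (Fintype.card T : ℂ)⁻¹ * Fintype.card (ι → F) := by
  rw [proj, Matrix.trace_smul, Matrix.trace_sum, Finset.sum_eq_single 0, Matrix.trace_smul,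
    trace_pauli]
  · simp [hz.map_zero]
  · intro v _ hv
    rw [Matrix.trace_smul, trace_pauli, if_neg, smul_zero]
    simpa using hv
  · simp

/-- The dimension is the trace of the projection, to which only the identity element contributes. -/
theorem finrank_fixedSpace_mul_card (hz : IsPhaseLift T z) :
    Module.finrank ℂ (fixedSpace hz.group) * Nat.card T = Fintype.card F ^ Fintype.card ι := by
  have := Fintype.ofFinite T
  have h := hz.isProj_proj.trace
  rw [Matrix.trace_toLin'_eq, hz.trace_proj] at h
  have h0 : (Fintype.card T : ℂ) ≠ 0 := Nat.cast_ne_zero.2 Fintype.card_ne_zero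
  rw [inv_mul_eq_iff_eq_mul₀ h0] at h
  rw [Nat.card_eq_fintype_card, ← Fintype.card_fun, mul_comm]
  exact_mod_cast h.symm

theorem fixedSpace_ne_bot (hz : IsPhaseLift T z) : fixedSpace hz.group ≠ ⊥ := by
  intro h
  have h1 := hz.finrank_fixedSpace_mul_card
  rw [h, finrank_bot, zero_mul] at h1
  exact pow_ne_zero _ Fintype.card_ne_zero h1.symm

theorem finrank_fixedSpace (hz : IsPhaseLift T z) {r : ℕ}
    (hr : Nat.card T = Fintype.card F ^ r) :
    r ≤ Fintype.card ι ∧ IsQECC (Fintype.card ι - r) (fixedSpace hz.group) := by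
  have h := hz.finrank_fixedSpace_mul_card
  rw [hr] at h
  have hle : r ≤ Fintype.card ι :=
    (Nat.pow_dvd_pow_iff_le_right Fintype.one_lt_card).1 (Dvd.intro_left _ h)
  refine ⟨hle, ?_⟩
  rw [← Nat.sub_add_cancel hle, pow_add] at h
  exact Nat.eq_of_mul_eq_mul_right (pow_pos Fintype.card_pos r) h

/-- The stabilizer element over `t` is unitary and fixes `x` and `y`, yet moving it past the error
costs a nontrivial phase; so the matrix element equals itself times that phase. -/
theorem star_dotProduct_pauli_mulVec (hz : IsPhaseLift T z) {e t : Symp F ι} (ht : t ∈ T)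
    (hte : phase (sympForm t e) ≠ 1) {x y : (ι → F) → ℂ} (hx : x ∈ fixedSpace hz.group)
    (hy : y ∈ fixedSpace hz.group) : star x ⬝ᵥ (pauli e *ᵥ y) = 0 := by
  rw [hz.mem_fixedSpace] at hx hy
  have hU := Matrix.mem_unitaryGroup_iff'.1 (smul_pauli_mem_unitaryGroup (hz.pow_eq_one t ht) t)
  rw [Matrix.star_eq_conjTranspose] at hU
  have h1 : (z t • pauli t) *ᵥ (pauli e *ᵥ y) = phase (-sympForm t e) • (pauli e *ᵥ y) := by
    conv_rhs => rw [← hy t ht]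
    rw [Matrix.mulVec_mulVec, Matrix.mulVec_mulVec, smul_mul_assoc, pauli_commute, mul_smul_comm,
      ← Matrix.smul_mulVec, smul_comm]
  have h2 : star x ⬝ᵥ (pauli e *ᵥ y) =
      star ((z t • pauli t) *ᵥ x) ⬝ᵥ ((z t • pauli t) *ᵥ (pauli e *ᵥ y)) := by
    rw [Matrix.star_mulVec, ← Matrix.dotProduct_mulVec, Matrix.mulVec_mulVec _ (z t • pauli t)ᴴ,
      hU, Matrix.one_mulVec]
  rw [hx t ht, h1, dotProduct_smul, smul_eq_mul] at h2
  have h3 : (phase (-sympForm t e) - 1) * (star x ⬝ᵥ (pauli e *ᵥ y)) = 0 := by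
    rw [sub_mul, ← h2, one_mul, sub_self]
  refine (mul_eq_zero.1 h3).resolve_left fun h4 => hte ?_
  have h5 := phase_neg_mul (sympForm t e)
  rwa [sub_eq_zero.1 h4, one_mul] at h5

open scoped ComplexOrder in
-- An error in `T` acts as a scalar on the code, and one outside the dual has vanishing matrix
-- elements. An error in the dual but outside `T` preserves the code; detection would make it a
-- scalar there, the trace against the projection forces that scalar to be zero, and unitarity
-- forbids this.
theorem detects_iff (hz : IsPhaseLift T z) (e : Symp F ι) :
    Detects (fixedSpace hz.group) (pauli e) ↔ (e ∈ sympDual T → e ∈ T) := by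
  constructor
  · rintro ⟨s, hs⟩ he
    by_contra hne
    have := Fintype.ofFinite T
    have hEQ : ∀ y ∈ fixedSpace hz.group, pauli e *ᵥ y ∈ fixedSpace hz.group := by
      intro y hy
      rw [hz.mem_fixedSpace] at hy ⊢
      intro t ht
      conv_rhs => rw [← hy t ht]
      rw [Matrix.mulVec_mulVec, Matrix.mulVec_mulVec, smul_mul_assoc, pauli_commute, mul_smul_comm,
        sympForm_swap, he t ht, neg_zero, neg_zero, phase_zero, one_smul]
    have hEs : ∀ y ∈ fixedSpace hz.group, pauli e *ᵥ y = s • y := by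
      intro y hy
      -- The difference lies in the code, so the detection condition can be tested against it and
      -- shows it orthogonal to itself.
      have h := Submodule.sub_mem _ (hEQ y hy) (Submodule.smul_mem _ s hy)
      have h1 := hs _ h y hy
      rw [← smul_eq_mul, ← dotProduct_smul, ← sub_eq_zero, ← dotProduct_sub] at h1
      exact sub_eq_zero.1 (dotProduct_star_self_eq_zero.1 h1)
    have hEP : pauli e * hz.proj = s • hz.proj := by
      apply Matrix.toLin'.injective
      ext1 x
      ext1
      simp only [LinearMap.comp_apply, Matrix.toLin'_mul, map_smul, LinearMap.smul_apply]
      rw [Matrix.toLin'_apply (pauli e)]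
      rw [hEs _ (hz.isProj_proj.map_mem _)]
    have htr := hz.trace_pauli_mul_proj hne
    rw [hEP, Matrix.trace_smul, hz.trace_proj, smul_eq_mul] at htr
    have h0 : (Fintype.card T : ℂ) ≠ 0 := Nat.cast_ne_zero.2 Fintype.card_ne_zero
    have h0' : (Fintype.card (ι → F) : ℂ) ≠ 0 := Nat.cast_ne_zero.2 Fintype.card_ne_zero
    have hs0 : s = 0 := (mul_eq_zero.1 htr).resolve_right (mul_ne_zero (inv_ne_zero h0) h0')
    obtain ⟨y, hy, hy0⟩ := Submodule.exists_mem_ne_zero_of_ne_bot hz.fixedSpace_ne_bot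
    apply hy0
    have h1 := hEs y hy
    have h2 : (pauli e)ᴴ *ᵥ (pauli e *ᵥ y) = y := by
      rw [Matrix.mulVec_mulVec, conjTranspose_pauli_mul, Matrix.one_mulVec]
    rw [← h2, h1, hs0, zero_smul, Matrix.mulVec_zero]
  · intro h
    by_cases he : e ∈ sympDual T
    · refine ⟨(z e)⁻¹, fun x _ y hy => ?_⟩
      have h1 := hz.mem_fixedSpace.1 hy e (h he)
      rw [Matrix.smul_mulVec] at h1
      conv_rhs => rw [← h1]
      rw [dotProduct_smul, smul_eq_mul, inv_mul_cancel_left₀ (hz.ne_zero (h he))]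
    · obtain ⟨t, ht, hte⟩ : ∃ t ∈ T, sympForm e t ≠ 0 := by
        by_contra! hcon
        exact he hcon
      have hte' : sympForm t e ≠ 0 := by rwa [sympForm_swap, neg_ne_zero]
      obtain ⟨a, ha⟩ := exists_phase_mul_ne_one hte'
      rw [← sympForm_smul_left] at ha
      refine ⟨0, fun x hx y hy => ?_⟩
      rw [zero_mul, hz.star_dotProduct_pauli_mulVec (T.smul_mem a ht) ha hx hy]

end IsPhaseLift

end Stabilizer

/-! ### Alternating forms as pullbacks of standard symplectic forms. -/

section Symplectic

variable {K : Type*} [Field K]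

theorem exists_sympForm_ne_zero {ι : Type*} [Fintype ι] [DecidableEq ι] {u : Symp K ι}
    (hu : u ≠ 0) : ∃ v, sympForm v u ≠ 0 := by
  by_contra! h
  apply hu
  ext i
  · simpa [sympForm] using h (0, Pi.single i 1)
  · simpa [sympForm] using h (Pi.single i 1, 0)

/-- An alternating form is the pullback of a standard symplectic form under a surjection. -/
theorem exists_surjective_sympForm_eq {V : Type*} [AddCommGroup V] [Module K V]
    [FiniteDimensional K V] (ω : V →ₗ[K] V →ₗ[K] K) (hω : ∀ x, ω x x = 0) :
    ∃ (c : ℕ) (B : V →ₗ[K] Symp K (Fin c)), Function.Surjective B ∧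
      ∀ x y, sympForm (B x) (B y) = ω x y := by
  induction hd : Module.finrank K V using Nat.strong_induction_on generalizing V with
  | _ d ih =>
  by_cases h0 : ∀ x y, ω x y = 0
  · refine ⟨0, 0, fun y => ⟨0, Subsingleton.elim _ _⟩, fun x y => ?_⟩
    rw [h0]
    simp [sympForm]
  push Not at h0
  obtain ⟨v, w', hvw'⟩ := h0
  obtain ⟨w, hvw⟩ : ∃ w, ω v w = 1 := ⟨(ω v w')⁻¹ • w', by simp [hvw']⟩
  have hneg : ∀ x y, ω x y = -ω y x := by
    intro x y
    have h := hω (x + y)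
    simp only [map_add, LinearMap.add_apply, hω, zero_add, add_zero] at h
    exact eq_neg_of_add_eq_zero_right h
  have hwv : ω w v = -1 := by rw [hneg, hvw]
  -- Split off the hyperbolic plane spanned by `v` and `w`; its orthogonal complement `P` has
  -- smaller dimension and contains the radical.
  let P : Submodule K V := LinearMap.ker (ω v) ⊓ LinearMap.ker (ω w)
  have hP : ∀ x ∈ P, ω v x = 0 ∧ ω w x = 0 := fun x hx => hx
  have hlt : Module.finrank K P < d := by
    rw [← hd]
    refine Submodule.finrank_lt fun h => ?_
    have h1 := (hP w (h ▸ Submodule.mem_top)).1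
    rw [hvw] at h1
    exact one_ne_zero h1
  obtain ⟨c, B, hB, hBω⟩ := ih _ hlt (ω.domRestrict₁₂ P P) (fun x => hω x) rfl
  let π₀ : V →ₗ[K] V := LinearMap.id - (ω.flip w).smulRight v - (ω v).smulRight w
  have hπ₀ : ∀ x, π₀ x = x - ω x w • v - ω v x • w := fun x => rfl
  let π : V →ₗ[K] P := π₀.codRestrict P (by
    intro x
    constructor
    · simp [hπ₀, hω, hvw]
    · simp [hπ₀, hω, hwv, hneg x w])
  have hπ : ∀ x, (π x : V) = x - ω x w • v - ω v x • w := fun x => rfl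
  -- The new first pair of coordinates holds the coefficients of `v` and `w`; the rest comes from
  -- the component in `P`.
  let C : V →ₗ[K] Symp K (Fin (c + 1)) :=
    { toFun := fun x => (vecCons (ω x w) (B (π x)).1, vecCons (ω v x) (B (π x)).2)
      map_add' := by intro x y; simp
      map_smul' := by intro t x; simp }
  refine ⟨c + 1, C, ?_, ?_⟩
  · rintro ⟨a, b⟩
    obtain ⟨y, hy⟩ := hB (vecTail a, vecTail b)
    have hyP := hP y y.2
    have hyw : ω y w = 0 := by rw [hneg, hyP.2, neg_zero]
    have h1 : ω (vecHead a • v + vecHead b • w + y) w = vecHead a := by simp [hvw, hω, hyw]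
    have h2 : ω v (vecHead a • v + vecHead b • w + y) = vecHead b := by simp [hvw, hω, hyP.1]
    have h3 : π (vecHead a • v + vecHead b • w + y) = y := by
      apply Subtype.ext
      rw [hπ, h1, h2]
      abel
    refine ⟨vecHead a • v + vecHead b • w + y, ?_⟩
    change (vecCons _ _, vecCons _ _) = _
    rw [h1, h2, h3, hy, cons_head_tail, cons_head_tail]
  · intro x y
    have h := hBω (π x) (π y)
    change _ = ω (π x : V) (π y : V) at h
    rw [hπ, hπ] at h
    change (vecCons _ _) ⬝ᵥ (vecCons _ _) - (vecCons _ _) ⬝ᵥ (vecCons _ _) = _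
    rw [cons_dotProduct_cons, cons_dotProduct_cons]
    simp only [map_sub, map_smul, LinearMap.sub_apply, LinearMap.smul_apply, smul_eq_mul, hω, hvw,
      hwv, hneg w y, hneg x v, sympForm] at h
    linear_combination h

/-- The symplectic form as a bilinear map. -/
def sympBilin (K ι : Type*) [Field K] [Fintype ι] : Symp K ι →ₗ[K] Symp K ι →ₗ[K] K :=
  LinearMap.mk₂ K sympForm
    (by intros; simp only [sympForm, Prod.fst_add, Prod.snd_add, add_dotProduct]; ring)
    (by intros; simp only [sympForm, Prod.smul_fst, Prod.smul_snd, smul_dotProduct, smul_eq_mul]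
        ring)
    (by intros; simp only [sympForm, Prod.fst_add, Prod.snd_add, dotProduct_add]; ring)
    (by intros; simp only [sympForm, Prod.smul_fst, Prod.smul_snd, dotProduct_smul, smul_eq_mul]
        ring)

theorem sympForm_self {ι : Type*} [Fintype ι] (u : Symp K ι) : sympForm u u = 0 := by
  rw [sympForm, dotProduct_comm, sub_self]

/-- The sign is chosen so that the products of Alice's and Bob's parts cancel. Since the target form
is nondegenerate and `B` is onto, the kernel of `B` is the radical, and rank–nullity fixes the
number of ebits. -/
theorem exists_surjective_sympForm_eq_neg {ι : Type*} [Fintype ι] (S : Submodule K (Symp K ι))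
    {c : ℕ} (hS : Module.finrank K S = Module.finrank K ↥(S ⊓ sympDual S) + 2 * c) :
    ∃ B : S →ₗ[K] Symp K (Fin c), Function.Surjective B ∧
      ∀ x y, sympForm (B x) (B y) = -sympForm (x : Symp K ι) y := by
  obtain ⟨c', B, hB, hBω⟩ := exists_surjective_sympForm_eq
    (-(sympBilin K ι).domRestrict₁₂ S S) (fun x => neg_eq_zero.2 (sympForm_self _))
  have hker : (LinearMap.ker B).map S.subtype = S ⊓ sympDual S := by
    ext u
    constructor
    · rintro ⟨s, hs, rfl⟩
      refine ⟨s.2, fun v hv => ?_⟩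
      have h := hBω s ⟨v, hv⟩
      rw [LinearMap.mem_ker.1 hs] at h
      have h' : sympForm (0 : Symp K (Fin c')) (B ⟨v, hv⟩) = 0 := by simp [sympForm]
      rw [h'] at h
      exact neg_eq_zero.1 h.symm
    · rintro ⟨hu, hu'⟩
      refine ⟨⟨u, hu⟩, LinearMap.mem_ker.2 ?_, rfl⟩
      by_contra hne
      obtain ⟨y, hy⟩ := exists_sympForm_ne_zero hne
      obtain ⟨s, rfl⟩ := hB y
      apply hy
      rw [hBω]
      change -sympForm (s : Symp K ι) u = 0
      have h := hu' s s.2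
      rw [sympForm, dotProduct_comm, dotProduct_comm u.2] at h
      rw [sympForm]
      linear_combination h
  have h1 := LinearMap.finrank_range_add_finrank_ker B
  rw [LinearMap.range_eq_top.2 hB, finrank_top, ← Submodule.finrank_map_subtype_eq S, hker, hS,
    Module.finrank_prod, Module.finrank_fin_fun] at h1
  obtain rfl : c' = c := by omega
  exact ⟨B, hB, hBω⟩

end Symplectic

/-! ### Isometries into a given subspace, from orthonormal bases. -/

section Isometry

theorem exists_isometry_range_le {X κ : Type*} [Fintype X] [Fintype κ] [DecidableEq κ]
    (Q : Submodule ℂ (X → ℂ)) (h : Fintype.card κ ≤ Module.finrank ℂ Q) :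
    ∃ V : Matrix X κ ℂ, Vᴴ * V = 1 ∧ LinearMap.range V.mulVecLin ≤ Q := by
  let e : (X → ℂ) ≃ₗ[ℂ] EuclideanSpace ℂ X := (WithLp.linearEquiv 2 ℂ (X → ℂ)).symm
  let Q' : Submodule ℂ (EuclideanSpace ℂ X) := Q.map (e : (X → ℂ) →ₗ[ℂ] EuclideanSpace ℂ X)
  have hQ' : Module.finrank ℂ Q' = Module.finrank ℂ Q := LinearEquiv.finrank_map_eq e Q
  let b := stdOrthonormalBasis ℂ Q'
  obtain ⟨f⟩ : Nonempty (κ ↪ Fin (Module.finrank ℂ Q')) :=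
    Function.Embedding.nonempty_of_card_le (by rwa [Fintype.card_fin, hQ'])
  refine ⟨Matrix.of fun x i => (b (f i) : EuclideanSpace ℂ X) x, ?_, ?_⟩
  · ext i j
    have h1 := orthonormal_iff_ite.1 b.orthonormal (f i) (f j)
    rw [Submodule.coe_inner, EuclideanSpace.inner_eq_star_dotProduct, dotProduct_comm] at h1
    simp only [f.injective.eq_iff] at h1
    rw [Matrix.one_apply, ← h1]
    rfl
  · rw [Matrix.range_mulVecLin, Submodule.span_le]
    rintro _ ⟨i, rfl⟩
    obtain ⟨y, hy, hye⟩ := (b (f i)).2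
    change (fun x => (b (f i) : EuclideanSpace ℂ X) x) ∈ Q
    rw [← hye]
    exact hy

theorem exists_isometry_range_eq {X κ : Type*} [Fintype X] [Fintype κ] [DecidableEq κ]
    (Q : Submodule ℂ (X → ℂ)) (h : Module.finrank ℂ Q = Fintype.card κ) :
    ∃ V : Matrix X κ ℂ, Vᴴ * V = 1 ∧ LinearMap.range V.mulVecLin = Q := by
  obtain ⟨V, hV, hle⟩ := exists_isometry_range_le (κ := κ) Q h.ge
  refine ⟨V, hV, Submodule.eq_of_le_of_finrank_eq hle ?_⟩
  have hinj : Function.Injective V.mulVecLin := by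
    intro x y hxy
    have h1 := congrArg (fun w => Vᴴ *ᵥ w) hxy
    simpa [Matrix.mulVec_mulVec, hV] using h1
  rw [LinearMap.finrank_range_of_inj hinj, h, Module.finrank_fintype_fun_eq_card]

end Isometry

/-! ### Joining Alice's and Bob's coordinates. -/

section Glue

variable {K ι κ : Type*} [Field K] [Fintype ι] [Fintype κ]

/-- Concatenation of symplectic vectors. -/
def glue (u : Symp K ι) (v : Symp K κ) : Symp K (ι ⊕ κ) := (Sum.elim u.1 v.1, Sum.elim u.2 v.2)

theorem sympForm_glue (u u' : Symp K ι) (v v' : Symp K κ) :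
    sympForm (glue u v) (glue u' v') = sympForm u u' + sympForm v v' := by
  simp only [sympForm, glue, sumElim_dotProduct_sumElim]
  ring

/-- The extension of the elements of `S` by the coordinates that `B` assigns to them. -/
def glueMap (S : Submodule K (Symp K ι)) (B : S →ₗ[K] Symp K κ) : S →ₗ[K] Symp K (ι ⊕ κ) where
  toFun s := glue (s : Symp K ι) (B s)
  map_add' s t := by
    ext (i | i) <;> simp [glue]
  map_smul' a s := by
    ext (i | i) <;> simp [glue]

end Glue

/-! ### From maximal mixedness on Bob's side to an encoder using ebits. -/

section Encoding

variable {F : Type*} [Field F] [Fintype F] [DecidableEq F]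

theorem star_dotProduct_pauli_mulVec_eq_sum {ι : Type*} [Fintype ι] [DecidableEq ι]
    (u : Symp F ι) (x y : (ι → F) → ℂ) :
    star x ⬝ᵥ (pauli u *ᵥ y) = ∑ w, star (x (w + u.1)) * (phase (u.2 ⬝ᵥ w) * y w) := by
  have h : ∀ w, (pauli u *ᵥ y) (w + u.1) = phase (u.2 ⬝ᵥ w) * y w := by
    intro w
    rw [Matrix.mulVec, dotProduct, Finset.sum_eq_single w]
    · simp [pauli]
    · intro w' _ hw'
      simp [pauli, Ne.symm hw']
    · simp
  rw [dotProduct, ← Equiv.sum_comp (Equiv.addRight u.1)]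
  simp only [Equiv.coe_addRight, h, Pi.star_apply]

theorem star_dotProduct_pauli_glue_mulVec {ι κ : Type*} [Fintype ι] [DecidableEq ι] [Fintype κ]
    [DecidableEq κ] (e : Symp F κ) (x y : (ι ⊕ κ → F) → ℂ) :
    star x ⬝ᵥ (pauli (glue 0 e) *ᵥ y) = ∑ j : κ → F, phase (e.2 ⬝ᵥ j) *
      ∑ a : ι → F, star (x (Sum.elim a (j + e.1))) * y (Sum.elim a j) := by
  rw [star_dotProduct_pauli_mulVec_eq_sum,
    ← Equiv.sum_comp (Equiv.sumArrowEquivProdArrow ι κ F).symm, Fintype.sum_prod_type,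
    Finset.sum_comm]
  refine Finset.sum_congr rfl fun j _ => ?_
  rw [Finset.mul_sum]
  refine Finset.sum_congr rfl fun a _ => ?_
  have h1 : (Equiv.sumArrowEquivProdArrow ι κ F).symm (a, j) = Sum.elim a j := rfl
  have h2 : Sum.elim a j + (glue (0 : Symp F ι) e).1 = Sum.elim a (j + e.1) := by
    ext (i | i) <;> simp [glue]
  have h3 : (glue (0 : Symp F ι) e).2 ⬝ᵥ Sum.elim a j = e.2 ⬝ᵥ j := by
    simp [glue, sumElim_dotProduct_sumElim]
  rw [h1, h2, h3]
  ring

/-- If no nontrivial Pauli operator on the second system is seen by a code, then the states of the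
code are maximally mixed on that system. -/
theorem sum_star_mul_eq_of_pauli_eq_zero {ι κ : Type*} [Fintype ι] [DecidableEq ι] [Fintype κ]
    [DecidableEq κ] {x y : (ι ⊕ κ → F) → ℂ}
    (h : ∀ e : Symp F κ, e ≠ 0 → star x ⬝ᵥ (pauli (glue 0 e) *ᵥ y) = 0) (i j : κ → F) :
    (Fintype.card (κ → F) : ℂ) * ∑ a : ι → F, star (x (Sum.elim a i)) * y (Sum.elim a j) =
      if i = j then star x ⬝ᵥ y else 0 := by
  -- Fourier inversion: the operators `X(i - j) Z(b)`, weighted by these phases and summed over `b`,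
  -- give `|κ → F|` times the matrix unit `|i⟩⟨j|` on the second system.
  have h1 : ∑ b : κ → F, phase (-(b ⬝ᵥ j)) * (star x ⬝ᵥ (pauli (glue 0 (i - j, b)) *ᵥ y)) =
      (Fintype.card (κ → F) : ℂ) *
        ∑ a : ι → F, star (x (Sum.elim a i)) * y (Sum.elim a j) := by
    simp only [star_dotProduct_pauli_glue_mulVec, Finset.mul_sum (s := Finset.univ (α := κ → F))]
    rw [Finset.sum_comm, Finset.sum_eq_single j]
    · have h2 : ∀ b : κ → F, phase (-(b ⬝ᵥ j)) * (phase (b ⬝ᵥ j) *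
          ∑ a : ι → F, star (x (Sum.elim a (j + (i - j)))) * y (Sum.elim a j)) =
          ∑ a : ι → F, star (x (Sum.elim a i)) * y (Sum.elim a j) := by
        intro b
        rw [← mul_assoc, phase_neg_mul, one_mul, add_sub_cancel]
      simp only [h2, Finset.sum_const, Finset.card_univ, nsmul_eq_mul]
    · intro j' _ hj'
      have h2 := sum_phase_dotProduct (j' - j)
      rw [if_neg (sub_ne_zero.2 hj')] at h2
      simp only [← mul_assoc, ← phase_add]
      rw [← Finset.sum_mul]
      simp only [sub_eq_neg_add, dotProduct_add, dotProduct_neg] at h2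
      rw [h2, zero_mul]
    · simp
  rw [← h1]
  split_ifs with hij
  · subst hij
    rw [Finset.sum_eq_single 0]
    · have h2 : glue (0 : Symp F ι) ((i - i, 0) : Symp F κ) = 0 := by
        ext (k | k) <;> simp [glue]
      rw [h2, pauli_zero, Matrix.one_mulVec, zero_dotProduct, neg_zero, phase_zero, one_mul]
    · intro b _ hb
      rw [h _ (fun h0 => hb (congrArg Prod.snd h0)), mul_zero]
    · simp
  · refine Finset.sum_eq_zero fun b _ => ?_
    rw [h _ (fun h0 => hij (sub_eq_zero.1 (congrArg Prod.fst h0))), mul_zero]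

theorem exists_eaEncoder {n c k : ℕ} (Q : Submodule ℂ ((Fin n ⊕ Fin c → F) → ℂ))
    (hk : IsQECC k Q)
    (h : ∀ x ∈ Q, ∀ y ∈ Q, ∀ e : Symp F (Fin c), e ≠ 0 →
      star x ⬝ᵥ (pauli (glue 0 e) *ᵥ y) = 0) :
    ∃ W : Matrix (Fin n → F) ((Fin k → F) × (Fin c → F)) ℂ,
      Wᴴ * W = 1 ∧ Q = LinearMap.range (eaEncoder W).mulVecLin := by
  obtain ⟨U, hU, hUQ⟩ := exists_isometry_range_eq (κ := Fin k → F) Q (by rw [hk]; simp)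
  have hcol : ∀ s, U.col s ∈ Q := by
    intro s
    rw [← hUQ, Matrix.range_mulVecLin]
    exact Submodule.subset_span ⟨s, rfl⟩
  have hq : (0 : ℝ) < (Fintype.card F : ℝ) ^ c := pow_pos (Nat.cast_pos.2 Fintype.card_pos) c
  let a : ℝ := Real.sqrt ((Fintype.card F : ℝ) ^ c)
  have ha : a ≠ 0 := (Real.sqrt_pos.2 hq).ne'
  have haa : (a : ℂ) * a = Fintype.card (Fin c → F) := by
    rw [← Complex.ofReal_mul, Real.mul_self_sqrt hq.le]
    simp
  -- Bob's index of a code basis vector becomes an input index of `W`. The factor `a` cancels the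
  -- normalization of `ebits`, and maximal mixedness says exactly that the columns are orthonormal.
  refine ⟨Matrix.of fun x p => (a : ℂ) * U (Sum.elim x p.2) p.1, ?_, ?_⟩
  · ext ⟨s, i⟩ ⟨t, j⟩
    have h1 := sum_star_mul_eq_of_pauli_eq_zero (h _ (hcol s) _ (hcol t)) i j
    have h2 : star (U.col s) ⬝ᵥ U.col t = (1 : Matrix (Fin k → F) (Fin k → F) ℂ) s t := by
      rw [← hU]
      rfl
    rw [h2, ← haa, Finset.mul_sum] at h1
    rw [Matrix.mul_apply]
    have h3 : ((1 : Matrix ((Fin k → F) × (Fin c → F)) _ ℂ) (s, i) (t, j)) =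
        if i = j then (1 : Matrix (Fin k → F) (Fin k → F) ℂ) s t else 0 := by
      simp only [Matrix.one_apply, Prod.mk.injEq]
      split_ifs <;> simp_all
    rw [h3, ← h1]
    refine Finset.sum_congr rfl fun x _ => ?_
    rw [Matrix.conjTranspose_apply, Matrix.of_apply, Matrix.of_apply, star_mul']
    have h4 : star (a : ℂ) = a := Complex.conj_ofReal a
    rw [h4]
    simp only [Matrix.col_apply]
    ring
  · rw [← hUQ]
    congr 2
    ext x s
    have h5 : Sum.elim (x ∘ Sum.inl) (x ∘ Sum.inr) = x := Sum.elim_comp_inl_inr x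
    simp only [eaEncoder, ebits, Matrix.of_apply, mul_ite, mul_zero, Finset.sum_ite_eq',
      Finset.mem_univ, if_true, h5]
    rw [Complex.ofReal_inv, mul_right_comm, mul_inv_cancel₀ (Complex.ofReal_ne_zero.2 ha), one_mul]

end Encoding

/-! ### The entanglement-assisted code of `S`. -/

section EntanglementAssisted

variable {F : Type*} [Field F] [Fintype F] [DecidableEq F] {n c : ℕ}

theorem bijOn_alicePart_range_glueMap (S : Submodule F (Symp F (Fin n)))
    (B : S →ₗ[F] Symp F (Fin c)) :
    Set.BijOn alicePart (LinearMap.range (glueMap S B) : Set (Symp F (Fin n ⊕ Fin c)))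
      (S : Set (Symp F (Fin n))) := by
  refine ⟨?_, ?_, ?_⟩
  · rintro _ ⟨s, rfl⟩
    exact s.2
  · rintro _ ⟨s, rfl⟩ _ ⟨t, rfl⟩ hst
    have : s = t := Subtype.ext hst
    rw [this]
  · intro s hs
    exact ⟨glueMap S B ⟨s, hs⟩, ⟨_, rfl⟩, rfl⟩

theorem onAlice_eq_glue (u : Symp F (Fin n)) : onAlice c u = glue u 0 := rfl

theorem onAlice_mem_sympDual_range_glueMap {S : Submodule F (Symp F (Fin n))}
    {B : S →ₗ[F] Symp F (Fin c)} {u : Symp F (Fin n)} :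
    onAlice c u ∈ sympDual (LinearMap.range (glueMap S B)) ↔ u ∈ sympDual S := by
  have h : ∀ s : S, sympForm (onAlice c u) (glueMap S B s) = sympForm u s := by
    intro s
    change sympForm (glue u 0) (glue _ _) = _
    rw [sympForm_glue]
    simp [sympForm]
  constructor
  · intro hu s hs
    rw [← h ⟨s, hs⟩]
    exact hu _ ⟨_, rfl⟩
  · rintro hu _ ⟨s, rfl⟩
    rw [h]
    exact hu s s.2

/-- If `u` is in the radical of `S`, then `B u` is orthogonal to the whole image of `B`, hence zero,
so `u` is extended by zeros. -/
theorem onAlice_mem_range_glueMap {S : Submodule F (Symp F (Fin n))}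
    {B : S →ₗ[F] Symp F (Fin c)} (hB : Function.Surjective B)
    (hBω : ∀ x y, sympForm (B x) (B y) = -sympForm (x : Symp F (Fin n)) y)
    {u : Symp F (Fin n)} (hu : u ∈ sympDual S) :
    onAlice c u ∈ LinearMap.range (glueMap S B) ↔ u ∈ S := by
  constructor
  · rintro ⟨s, hs⟩
    have h : (s : Symp F (Fin n)) = u := congrArg alicePart hs
    exact h ▸ s.2
  · intro huS
    have h0 : B ⟨u, huS⟩ = 0 := by
      by_contra hne
      obtain ⟨y, hy⟩ := exists_sympForm_ne_zero hne
      obtain ⟨s, rfl⟩ := hB y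
      apply hy
      rw [sympForm_swap, hBω, neg_neg]
      exact hu s s.2
    refine ⟨⟨u, huS⟩, ?_⟩
    change glue u (B ⟨u, huS⟩) = _
    rw [h0, onAlice_eq_glue]

theorem exists_eaCode (S : Submodule F (Symp F (Fin n))) {l : ℕ}
    (hl : Module.finrank F ↥(S ⊓ sympDual S) = l)
    (hS : Module.finrank F S = l + 2 * c) :
    c + l ≤ n ∧ ∃ Q : Submodule ℂ ((Fin n ⊕ Fin c → F) → ℂ), EAStabilizes S Q ∧
      IsEAQECC (n - c - l) (minWeight ((sympDual S : Set (Symp F (Fin n))) \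
        ((S ⊓ sympDual S : Submodule F (Symp F (Fin n))) : Set (Symp F (Fin n))))) Q := by
  obtain ⟨B, hB, hBω⟩ := exists_surjective_sympForm_eq_neg S (c := c) (by rw [hl, hS])
  let T := LinearMap.range (glueMap S B)
  have hT : T ≤ sympDual T := by
    rintro _ ⟨s, rfl⟩ _ ⟨t, rfl⟩
    change sympForm (glue _ _) (glue _ _) = 0
    rw [sympForm_glue, hBω, add_neg_cancel]
  have hbij := bijOn_alicePart_range_glueMap S B
  have hcard : Nat.card T = Fintype.card F ^ (l + 2 * c) := by
    rw [← hS, ← Nat.card_eq_fintype_card (α := F), ← Module.natCard_eq_pow_finrank]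
    exact Nat.card_congr (hbij.equiv alicePart)
  obtain ⟨z, hz⟩ := exists_isPhaseLift hT
  obtain ⟨hle, hdim⟩ := hz.finrank_fixedSpace hcard
  rw [Fintype.card_sum, Fintype.card_fin, Fintype.card_fin] at hle hdim
  refine ⟨by omega, fixedSpace hz.group, ⟨T, hbij, hz.stabilizes⟩, ?_, ?_⟩
  · apply exists_eaEncoder
    -- No subtraction truncates here: `hle` gives `l + 2 * c ≤ n + c`, that is, `c + l ≤ n`.
    · rwa [show n - c - l = n + c - (l + 2 * c) by omega]
    · intro x hx y hy e he
      obtain ⟨f, hf⟩ := exists_sympForm_ne_zero he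
      -- Surjectivity of `B` supplies a stabilizer whose Bob part is `a • f`; the error is zero on
      -- Alice's side, so this part alone decides the phase.
      obtain ⟨a, ha⟩ := exists_phase_mul_ne_one hf
      rw [← sympForm_smul_left] at ha
      obtain ⟨s, hs⟩ := hB (a • f)
      refine hz.star_dotProduct_pauli_mulVec (t := glueMap S B s) ⟨s, rfl⟩ ?_ hx hy
      change phase (sympForm (glue _ _) (glue _ _)) ≠ 1
      rw [sympForm_glue, hs]
      have h0 : sympForm (s : Symp F (Fin n)) 0 = 0 := by simp [sympForm]
      rwa [h0, zero_add]
  · unfold eaDistance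
    congr 1
    ext u
    rw [Set.mem_ofPred_eq, hz.detects_iff, onAlice_mem_sympDual_range_glueMap]
    constructor
    · intro h
      push Not at h
      exact ⟨h.1, fun hu => h.2 ((onAlice_mem_range_glueMap hB hBω h.1).2 hu.1)⟩
    · rintro ⟨h1, h2⟩ h
      exact h2 ⟨(onAlice_mem_range_glueMap hB hBω h1).1 (h h1), h1⟩

end EntanglementAssisted

end EAQ

theorem theorem4 {F : Type*} [Field F] [Fintype F] [DecidableEq F] (n m l c r : ℕ)
    (S S_I S_E : Submodule F (EAQ.Symp F (Fin n))) (Sb : Submodule F (EAQ.Symp F (Fin m)))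
    (hS_I : S_I = S ⊓ EAQ.sympDual S)
    (hsum : S_I ⊔ S_E = S) (hdirect : S_I ⊓ S_E = ⊥)
    (hS_E : S_E ⊓ EAQ.sympDual S_E = ⊥)
    (hl : Nat.card S_I = Fintype.card F ^ l)
    (hc : Nat.card S_E = Fintype.card F ^ (2 * c))
    (hSb : Sb ≤ EAQ.sympDual Sb)
    (hr : Nat.card Sb = Fintype.card F ^ r)
    (hle : (c : ℤ) ≤ (m : ℤ) - (r : ℤ)) :
    ∃ (k kb : ℕ) (dea : ℕ∞),
      (k : ℤ) = (n : ℤ) - (c : ℤ) - (l : ℤ) ∧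
      (kb : ℤ) = (m : ℤ) - (r : ℤ) ∧
      dea = EAQ.minWeight
        ((EAQ.sympDual S : Set (EAQ.Symp F (Fin n))) \ (S_I : Set (EAQ.Symp F (Fin n)))) ∧
      ∃ (Qea : Submodule ℂ ((Fin n ⊕ Fin c → F) → ℂ)) (Qb : Submodule ℂ ((Fin m → F) → ℂ))
        (Qc : Submodule ℂ ((Fin n ⊕ Fin m → F) → ℂ)),
        EAQ.IsCombination S Sb k dea kb Qea Qb Qc := by
  classical
  -- Cardinalities become dimensions, so that the direct sum yields `l + 2 * c` for `S`.
  have hfin : ∀ {ι : Type} [Fintype ι] (P : Submodule F (EAQ.Symp F ι)) (e : ℕ),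
      Nat.card P = Fintype.card F ^ e → Module.finrank F P = e := by
    intro ι _ P e h
    rw [Module.natCard_eq_pow_finrank (K := F), Nat.card_eq_fintype_card] at h
    exact Nat.pow_right_injective Fintype.one_lt_card h
  have hrank : Module.finrank F S = l + 2 * c := by
    have h := Submodule.finrank_sup_add_finrank_inf_eq S_I S_E
    rwa [hsum, hdirect, finrank_bot, add_zero, hfin S_I l hl, hfin S_E _ hc] at h
  subst hS_I
  obtain ⟨hcl, Qea, hst, hea⟩ := EAQ.exists_eaCode S (hfin _ l hl) hrank
  obtain ⟨z, hz⟩ := EAQ.exists_isPhaseLift hSb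
  obtain ⟨hrm, hdim⟩ := hz.finrank_fixedSpace hr
  rw [Fintype.card_fin] at hrm hdim
  obtain ⟨V, hV, hVQ⟩ := EAQ.exists_isometry_range_le (κ := Fin c → F)
    (EAQ.fixedSpace hz.group) (by
      rw [hdim, Fintype.card_fun, Fintype.card_fin]
      exact Nat.pow_le_pow_right Fintype.card_pos (by omega))
  exact ⟨n - c - l, m - r, _, by omega, by omega, rfl, Qea, _, _,
    { ea_stabilizes := hst
      ea_code := hea
      stabilizes := hz.stabilizes
      code := hdim
      matching := by omega
      joined := ⟨V, hV, hVQ, rfl⟩ }⟩
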